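/- Conventions. A topological space is Tychonoff if it is completely regular and Hausdorff, and crowded if it has no isolated point. For a space $(X,\mathcal T)$: $\Delta(X,\mathcal T)$ is the smallest cardinality of a nonempty open set; $S(X,\mathcal T)$ is the least cardinal $\lambda$ such that no family of pairwise disjoint nonempty open sets has cardinality exactly $\lambda$; $\mathrm{nwd}(X,\mathcal T)$ is the smallest cardinality of a set $A\subseteq X$ whose closure has nonempty interior. For a cardinal $\tau$, the space is $\tau$-resolvable if it has a family of $\tau$ many pairwise disjoint dense subsets; it is maximally resolvable if it is $\Delta(X,\mathcal T)$-resolvable; it is extraresolvable (respectively, strongly extraresolvable) if there is a family $\mathcal D$ of dense subsets with $|\mathcal D|\ge\Delta(X,\mathcal T)^+$ such that $D\cap D'$ is nowhere dense (respectively, $|D\cap D'|<\mathrm{nwd}(X,\mathcal T)$) for all distinct $D,D'\in\mathcal D$. An expansion of $\mathcal T$ is a topology $\mathcal U\supseteq\mathcal T$ on $X$. Theorem. Let $(X,\mathcal T)$ be a crowded, maximally resolvable Tychonoff space with $S(X,\mathcal T)\le\Delta(X,\mathcal T)=\kappa$. Call an expansion $\mathcal U$ of $\mathcal T$ suitable if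 $(X,\mathcal U)$ is Tychonoff, $\Delta(X,\mathcal U)=\Delta(X,\mathcal T)$ and $S(X,\mathcal U)\le\Delta(X,\mathcal U)$. Then: (1) there is a suitable expansion $\mathcal U_1$ such that $(X,\mathcal U_1)$ is $\omega$-resolvable but not maximally resolvable; (2) for every regular cardinal $\kappa'$ with $S(X,\mathcal T)\le\kappa'\le\kappa$ there is a suitable expansion $\mathcal U_2$ such that $(X,\mathcal U_2)$ is $\tau$-resolvable for every cardinal $\tau<\kappa'$ but not $\kappa'$-resolvable; (3) there is a suitable expansion $\mathcal U_3$ such that $(X,\mathcal U_3)$ is maximally resolvable but not extraresolvable; (4) there is a suitable expansion $\mathcal U_4$ such that $(X,\mathcal U_4)$ is extraresolvable but not maximally resolvable; (5) there is a suitable expansion $\mathcal U_5$ such that $(X,\mathcal U_5)$ is maximally resolvable and extraresolvable but not strongly extraresolvable. -/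

import Mathlib

open Cardinal
open scoped Topology

universe u

namespace Resolvability

variable {X : Type u}

/-- No point of the space is isolated. -/
def IsCrowded (T : TopologicalSpace X) : Prop :=
  ∀ x : X, ¬ IsOpen[T] {x}

/-- The dispersion character: the smallest cardinality of a nonempty open set. -/
noncomputable def dispersionCharacter (T : TopologicalSpace X) : Cardinal.{u} :=
  sInf {c | ∃ U : Set X, IsOpen[T] U ∧ U.Nonempty ∧ #U = c}

/-- The nowhere density number: the smallest cardinality of a set whose closure has
nonempty interior. -/
noncomputable def nowhereDensityNumber (T : TopologicalSpace X) : Cardinal.{u} :=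
  sInf {c | ∃ A : Set X, (@interior X T (closure[T] A)).Nonempty ∧ #A = c}

/-- A family of nonempty, pairwise disjoint open sets. -/
def IsCellularFamily (T : TopologicalSpace X) (C : Set (Set X)) : Prop :=
  (∀ U ∈ C, IsOpen[T] U ∧ U.Nonempty) ∧ C.Pairwise Disjoint

/-- The Souslin number: the least cardinal that is not the cardinality of a cellular family. -/
noncomputable def souslinNumber (T : TopologicalSpace X) : Cardinal.{u} :=
  sInf {c | ¬ ∃ C : Set (Set X), IsCellularFamily T C ∧ #C = c}

/-- There is a family of `c` many pairwise disjoint dense sets. -/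
def IsResolvable (T : TopologicalSpace X) (c : Cardinal.{u}) : Prop :=
  ∃ 𝒟 : Set (Set X), #𝒟 = c ∧ (∀ D ∈ 𝒟, @Dense X T D) ∧ 𝒟.Pairwise Disjoint

def IsMaximallyResolvable (T : TopologicalSpace X) : Prop :=
  IsResolvable T (dispersionCharacter T)

/-- There are more than `Δ(X)` many dense sets, any two distinct ones of which have nowhere
dense intersection. -/
def IsExtraresolvable (T : TopologicalSpace X) : Prop :=
  ∃ 𝒟 : Set (Set X), Order.succ (dispersionCharacter T) ≤ #𝒟 ∧ (∀ D ∈ 𝒟, @Dense X T D) ∧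
    𝒟.Pairwise fun D E => @IsNowhereDense X T (D ∩ E)

/-- There are more than `Δ(X)` many dense sets, any two distinct ones of which meet in fewer
than `nwd(X)` points. -/
def IsStronglyExtraresolvable (T : TopologicalSpace X) : Prop :=
  ∃ 𝒟 : Set (Set X), Order.succ (dispersionCharacter T) ≤ #𝒟 ∧ (∀ D ∈ 𝒟, @Dense X T D) ∧
    𝒟.Pairwise fun D E => #(D ∩ E : Set X) < nowhereDensityNumber T

/-- `U` is a Tychonoff expansion of `T` (every `T`-open set is `U`-open; in Mathlib's order on
topologies this is `U ≤ T`) with `Δ(X, U) = Δ(X, T)` and `S(X, U) ≤ Δ(X, U)`. -/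
structure IsSuitableExpansion (T U : TopologicalSpace X) : Prop where
  expansion : U ≤ T
  tychonoff : @T35Space X U
  dispersionCharacter_eq : dispersionCharacter U = dispersionCharacter T
  souslinNumber_le : souslinNumber U ≤ dispersionCharacter U

end Resolvability

/-! Write κ for the dispersion character. Every required topology adds at most 2 ^ κ clopen sets to
`T`, which preserves the Tychonoff property. Pulling a Hausdorff independent family back along κ × κ
disjoint dense sets gives 2 ^ κ functions that are independent on every nonempty open set, with κ
witnesses for each finite prescription. Some serve as labellings `L m`; the others define clopen
sets `B k`.

The labellings create resolvability. For fixed `m`, the sets of points with label `r ∈ R m` are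
disjoint and stay dense. For `m ≠ m'`, infinitely many clopen sets `B (m, m', n)` contain all points
permissibly labelled by both, while a basic open set can still be shrunk to avoid one of them; so
dense sets from different labellings meet in nowhere dense sets.

No essentially different dense sets survive. Each subset `S` of an open set `W` of size κ has its
own clopen set, from which `S` is removed whenever this keeps all admissible cells of size κ
(`exists_maximal_pruning`). If `E` is dense in the expansion, `E ∩ W` cannot have been removed, so
by maximality `E` contains some admissible cell up to fewer than κ points (`exists_isControlled`). A
Δ-system type argument finds, among μ such cells, two with a common admissible subcell, for regular
uncountable μ at least the Souslin number and above all sizes of `R m`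
(`exists_isAdmissible_carrier_subset`). So two of any μ dense sets meet in at least κ points. The
five parts differ only in the choice of `M` and `R`. -/

namespace Resolvability

/-! ### Infinite combinatorics: independent functions, pruning, compatible partial functions. -/

section Combinatorics

open Classical in
/-- Hausdorff's independent family, in the form of Engelking and Karłowicz: on a set of size `#V`
there are `2 ^ #V` functions into `Option V` such that finitely many of them take any prescribed
values simultaneously. -/
theorem exists_independent_functions (V : Type u) [Infinite V] :
    ∃ (I : Type u) (h : Set V → I → Option V), #I = #V ∧
      ∀ (s : Finset (Set V)) (v : Set V → Option V), ∃ i, ∀ Y ∈ s, h Y i = v Y := by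
  let _ : Zero (Option V) := ⟨none⟩
  -- An index is a finite set `a` with a finite table `g`; the function of `Y` reads `g` at `a ∩ Y`.
  -- If `a` contains a point of each symmetric difference of the given sets, their traces on `a` are
  -- distinct and the table can be prescribed freely.
  refine ⟨Finset V × (Finset V →₀ Option V),
    fun Y i => i.2 (i.1.filter (· ∈ Y)), ?_, fun s v => ?_⟩
  · have h1 : #(Option V) = #V := by
      rw [mk_option, add_one_eq (aleph0_le_mk V)]
    rw [mk_prod, lift_id, lift_id, mk_finset_of_infinite, mk_finsupp_of_infinite',
      mk_finset_of_infinite, h1, max_self, mul_eq_self (aleph0_le_mk V)]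
  · let pt : Set V × Set V → V := fun p =>
      if h : (symmDiff p.1 p.2).Nonempty then h.some else Classical.arbitrary V
    let a : Finset V := (s ×ˢ s).image pt
    let φ : Set V → Finset V := fun Y => a.filter (· ∈ Y)
    have hφ : ∀ Y ∈ s, ∀ Z ∈ s, φ Y = φ Z → Y = Z := by
      intro Y hY Z hZ h
      by_contra hne
      have hn : (symmDiff Y Z).Nonempty := Set.nonempty_iff_ne_empty.2 fun h0 =>
        hne (symmDiff_eq_bot.1 h0)
      have hp : pt (Y, Z) ∈ symmDiff Y Z := by
        simp only [pt, dif_pos hn]; exact hn.some_mem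
      have ha : pt (Y, Z) ∈ a :=
        Finset.mem_image_of_mem pt (Finset.mk_mem_product hY hZ)
      have key := Finset.ext_iff.1 h (pt (Y, Z))
      simp only [φ, Finset.mem_filter, ha, true_and] at key
      rcases hp with hp | hp
      · exact hp.2 (key.1 hp.1)
      · exact hp.2 (key.2 hp.1)
    let g : Finset V →₀ Option V := Finsupp.onFinset (s.image φ)
      (fun b => if h : ∃ Y ∈ s, φ Y = b then v h.choose else none) (by
        intro b hb
        by_contra hc
        apply hb
        rw [dif_neg]
        · rfl
        · rintro ⟨Y, hY, rfl⟩
          exact hc (Finset.mem_image_of_mem φ hY))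
    refine ⟨(a, g), fun Y hY => ?_⟩
    have hex : ∃ Z ∈ s, φ Z = φ Y := ⟨Y, hY, rfl⟩
    change (if h : ∃ Z ∈ s, φ Z = φ Y then v h.choose else none) = v Y
    rw [dif_pos hex, hφ _ hex.choose_spec.1 _ hY hex.choose_spec.2]

/-- The points whose pattern of membership in the sets `B k`, `k ∈ s`, is prescribed by `e`. -/
def patternSet {X K : Type u} (B : K → Set X) (s : Finset K) (e : Set K) : Set X :=
  {x | ∀ k ∈ s, (x ∈ B k ↔ k ∈ e)}

/-- The family obtained from `B` by removing `A k` from `B k` for the indices `k` in `𝓜`. -/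
def pruned {X K : Type u} (B A : K → Set X) (𝓜 : Set K) (k : K) : Set X :=
  {x ∈ B k | k ∈ 𝓜 → x ∉ A k}

/-- One can remove the sets `A k` from the sets `B k` for a maximal set of indices `k` such that
all the given pattern sets stay of size at least `κ`; for the remaining indices, some pattern set
is contained in `A k` up to fewer than `κ` points. -/
theorem exists_maximal_pruning {X K : Type u} (B A : K → Set X) (κ : Cardinal.{u})
    (𝒞 : Set (Set X × Finset K × Set K))
    (h : ∀ c ∈ 𝒞, κ ≤ #(c.1 ∩ patternSet B c.2.1 c.2.2 : Set X)) :
    ∃ 𝓜 : Set K, (∀ c ∈ 𝒞, κ ≤ #(c.1 ∩ patternSet (pruned B A 𝓜) c.2.1 c.2.2 : Set X)) ∧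
      ∀ k ∉ 𝓜, ∃ c ∈ 𝒞, #((c.1 ∩ patternSet (pruned B A 𝓜) c.2.1 c.2.2) \ A k : Set X) < κ := by
  classical
  have hloc : ∀ (M N : Set K) (s : Finset K) (e : Set K), (∀ k ∈ s, (k ∈ M ↔ k ∈ N)) →
      patternSet (pruned B A M) s e = patternSet (pruned B A N) s e := by
    intro M N s e hs
    ext x
    refine forall₂_congr fun k hk => ?_
    simp only [pruned, Set.mem_ofPred_eq, hs k hk]
  obtain ⟨M, -, hM⟩ := zorn_subset_nonempty
    {M : Set K | ∀ c ∈ 𝒞, κ ≤ #(c.1 ∩ patternSet (pruned B A M) c.2.1 c.2.2 : Set X)}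
    (by
      intro ch hch hchain hne
      refine ⟨⋃₀ ch, fun c hc => ?_, fun N hN => Set.subset_sUnion_of_mem hN⟩
      -- A pattern involves finitely many indices, so one member of the chain already decides it.
      obtain ⟨N, hN, hsub⟩ := DirectedOn.exists_mem_subset_of_finset_subset_biUnion hne
        (f := fun N : Set K => N) (s := {k ∈ c.2.1 | k ∈ ⋃₀ ch}) hchain.directedOn
        (by intro k hk; simpa using (Finset.mem_filter.1 hk).2)
      rw [hloc (⋃₀ ch) N _ _ fun k hk => ⟨fun h => hsub (Finset.mem_filter.2 ⟨hk, h⟩),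
        fun h => ⟨N, hN, h⟩⟩]
      exact hch hN c hc) ∅ (by
      intro c hc
      have : pruned B A ∅ = B := by funext k; simp [pruned]
      rw [this]
      exact h c hc)
  refine ⟨M, hM.prop, fun k hk => ?_⟩
  by_contra hcon
  push Not at hcon
  refine hk (hM.le_of_ge (y := insert k M) (fun c hc => (hcon c hc).trans ?_)
    (Set.subset_insert k M) (Set.mem_insert k M))
  -- Points outside `A k` do not notice the additional pruning at `k`.
  refine mk_le_mk_of_subset ?_
  rintro x ⟨⟨hx, hxp⟩, hxA⟩
  refine ⟨hx, fun l hl => ?_⟩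
  rw [← hxp l hl]
  by_cases hlk : l = k
  · subst hlk
    simp [pruned, hk, hxA]
  · simp [pruned, hlk]

/-- A family of finite partial functions with few values at each coordinate has a subfamily of
the same regular uncountable size whose members are pairwise compatible. -/
theorem exists_compatible_subfamily {ι C Y : Type u} {μ : Cardinal.{u}} (hμ : μ.IsRegular)
    (hμ' : ℵ₀ < μ) (u : ι → Finset C) (w : ι → C → Y) (Q : C → Set Y)
    (hw : ∀ i, ∀ c ∈ u i, w i c ∈ Q c) (hQ : ∀ c, #(Q c) < μ) (hι : μ ≤ #ι) :
    ∃ J : Set ι, μ ≤ #J ∧ ∀ i ∈ J, ∀ j ∈ J, ∀ c ∈ u i, c ∈ u j → w i c = w j c := by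
  classical
  have key : ∀ (n : ℕ) (S : Set ι) (u : ι → Finset C), μ ≤ #S → (∀ i ∈ S, (u i).card = n) →
      (∀ i ∈ S, ∀ c ∈ u i, w i c ∈ Q c) →
      ∃ J ⊆ S, μ ≤ #J ∧ ∀ i ∈ J, ∀ j ∈ J, ∀ c ∈ u i, c ∈ u j → w i c = w j c := by
    intro n
    induction n with
    | zero =>
      intro S u hS hu _
      refine ⟨S, subset_rfl, hS, fun i hi j _ c hc => ?_⟩
      rw [Finset.card_eq_zero.1 (hu i hi)] at hc
      simp at hc
    | succ n ih =>
      intro S u hS hu hwS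
      -- Either a coordinate shared by μ domains can be given a fixed value by pigeonhole and
      -- erased, or a maximal subfamily with disjoint domains has size μ: otherwise fewer than μ
      -- sets of size less than μ would cover `S`.
      by_cases hex : ∃ c, μ ≤ #{i ∈ S | c ∈ u i}
      · obtain ⟨c, hc⟩ := hex
        obtain ⟨q, S', hS', hcard, hval⟩ := infinite_pigeonhole_set
          (s := {i ∈ S | c ∈ u i}) (fun i => (⟨w i c, hwS i i.2.1 c i.2.2⟩ : Q c)) μ hc hμ.1
          (by rw [hμ.cof_ord]; exact hQ c)
        obtain ⟨J, hJS, hJ, hcomp⟩ := ih S' (fun i => (u i).erase c) hcard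
          (fun i hi => by
            rw [Finset.card_erase_of_mem (hS' hi).2, hu i (hS' hi).1, Nat.add_sub_cancel])
          (fun i hi d hd => hwS i (hS' hi).1 d (Finset.mem_of_mem_erase hd))
        refine ⟨J, fun i hi => (hS' (hJS hi)).1, hJ, fun i hi j hj d hdi hdj => ?_⟩
        by_cases hdc : d = c
        · subst hdc
          have h1 := congrArg Subtype.val (hval (hJS hi))
          have h2 := congrArg Subtype.val (hval (hJS hj))
          exact h1.trans h2.symm
        · exact hcomp i hi j hj d (Finset.mem_erase.2 ⟨hdc, hdi⟩) (Finset.mem_erase.2 ⟨hdc, hdj⟩)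
      · push Not at hex
        obtain ⟨J, -, hJ⟩ := zorn_subset_nonempty
          {J : Set ι | J ⊆ S ∧ J.Pairwise fun i j => Disjoint (u i) (u j)}
          (by
            intro ch hch hchain _
            refine ⟨⋃₀ ch, ⟨Set.sUnion_subset fun N hN => (hch hN).1, ?_⟩,
              fun N hN => Set.subset_sUnion_of_mem hN⟩
            exact (Set.pairwise_sUnion hchain.directedOn).2 fun N hN => (hch hN).2)
          ∅ ⟨Set.empty_subset S, Set.pairwise_empty _⟩
        refine ⟨J, hJ.prop.1, ?_, fun i hi j hj c hci hcj => ?_⟩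
        · by_contra hlt
          push Not at hlt
          have hcov : S ⊆ ⋃ i ∈ J, ⋃ c ∈ u i, {j ∈ S | c ∈ u j} := by
            intro j hj
            by_cases hjJ : j ∈ J
            · obtain ⟨c, hc⟩ := Finset.card_pos.1 (by rw [hu j hj]; exact n.succ_pos)
              simp only [Set.mem_iUnion]
              exact ⟨j, hjJ, c, hc, hj, hc⟩
            · by_contra hnot
              simp only [Set.mem_iUnion, not_exists] at hnot
              refine hjJ (hJ.le_of_ge (y := insert j J) ⟨Set.insert_subset hj hJ.prop.1, ?_⟩
                (Set.subset_insert j J) (Set.mem_insert j J))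
              refine hJ.prop.2.insert fun i hi _ => ?_
              have : Disjoint (u j) (u i) := Finset.disjoint_left.2 fun c hcj hci =>
                hnot i hi c hci ⟨hj, hcj⟩
              exact ⟨this, this.symm⟩
          refine absurd (mk_le_mk_of_subset hcov) (not_le.2 (lt_of_lt_of_le ?_ hS))
          rw [card_biUnion_lt_iff_forall_of_isRegular hμ hlt]
          intro i _
          have hfin : #(u i : Set C) < μ := (by simp : #(u i : Set C) < ℵ₀).trans hμ'
          exact (card_biUnion_lt_iff_forall_of_isRegular (s := (u i : Set C))
            (t := fun c _ => {j ∈ S | c ∈ u j}) hμ hfin).2 fun c _ => hex c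
        · by_cases hij : i = j
          · rw [hij]
          · exact absurd hcj (Finset.disjoint_left.1 (hJ.prop.2 hi hj hij) hci)
  obtain ⟨n, hn⟩ := infinite_pigeonhole_card (fun i => (ULift.up (u i).card : ULift.{u} ℕ)) μ hι
    hμ.1 (by rw [hμ.cof_ord]; simpa using hμ')
  obtain ⟨J, -, hJ, hcomp⟩ := key n.down _ u hn
    (fun i hi => congrArg ULift.down (Set.mem_singleton_iff.1 hi)) (fun i _ => hw i)
  exact ⟨J, hJ, hcomp⟩

end Combinatorics
-- Cellular families and the Erdős–Tarski theorem.
section Souslin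

variable {X : Type u} {T : TopologicalSpace X}

theorem IsCellularFamily.subset {C D : Set (Set X)} (hC : IsCellularFamily T C) (h : D ⊆ C) :
    IsCellularFamily T D :=
  ⟨fun U hU => hC.1 U (h hU), hC.2.mono h⟩

theorem not_le_mk_of_souslinNumber_le {μ : Cardinal.{u}} (hμ : souslinNumber T ≤ μ)
    {C : Set (Set X)} (hC : IsCellularFamily T C) : ¬ μ ≤ #C := by
  intro h
  have hne : {c : Cardinal.{u} | ¬ ∃ C : Set (Set X), IsCellularFamily T C ∧ #C = c}.Nonempty := by
    refine ⟨Order.succ #(Set X), ?_⟩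
    rintro ⟨D, -, hD⟩
    exact absurd (mk_set_le D) (not_le.2 (hD ▸ Order.lt_succ _))
  obtain ⟨D, hDC, hD⟩ := le_mk_iff_exists_subset.1 (hμ.trans h)
  exact csInf_mem hne ⟨D, hC.subset hDC, hD⟩

theorem exists_isCellularFamily_of_lt {μ : Cardinal.{u}} (hμ : μ < souslinNumber T) :
    ∃ C : Set (Set X), IsCellularFamily T C ∧ #C = μ := by
  by_contra h
  exact notMem_of_lt_csInf' hμ h

theorem souslinNumber_le_of_forall {μ : Cardinal.{u}}
    (h : ∀ C : Set (Set X), IsCellularFamily T C → #C ≠ μ) : souslinNumber T ≤ μ :=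
  csInf_le' (by rintro ⟨C, hC, hCμ⟩; exact h C hC hCμ)

/-- There is a cellular family of at least `μ` many subsets of `O`. -/
def HasCellularFamily (T : TopologicalSpace X) (O : Set X) (μ : Cardinal.{u}) : Prop :=
  ∃ C : Set (Set X), IsCellularFamily T C ∧ (∀ U ∈ C, U ⊆ O) ∧ μ ≤ #C

theorem HasCellularFamily.mono {O : Set X} {μ ν : Cardinal.{u}} (h : HasCellularFamily T O μ)
    (hν : ν ≤ μ) : HasCellularFamily T O ν :=
  let ⟨C, h1, h2, h3⟩ := h
  ⟨C, h1, h2, hν.trans h3⟩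

/-- An indexed family of nonempty pairwise disjoint open sets gives a cellular family. -/
theorem isCellularFamily_range {ι : Type u} {O : ι → Set X} (hO : ∀ i, IsOpen[T] (O i))
    (hne : ∀ i, (O i).Nonempty) (hd : Pairwise (Function.onFun Disjoint O)) :
    IsCellularFamily T (Set.range O) ∧ #(Set.range O) = #ι := by
  refine ⟨⟨?_, hd.range_pairwise⟩, mk_range_eq O fun i j hij => ?_⟩
  · rintro _ ⟨i, rfl⟩
    exact ⟨hO i, hne i⟩
  · by_contra hne'
    have := hd hne'
    rw [Function.onFun, hij, disjoint_self] at this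
    exact (hne j).ne_empty this

theorem isCellularFamily_iUnion {ι : Type u} {O : ι → Set X} {C : ι → Set (Set X)}
    (hd : Pairwise (Function.onFun Disjoint O)) (hC : ∀ i, IsCellularFamily T (C i))
    (hCO : ∀ i, ∀ U ∈ C i, U ⊆ O i) : IsCellularFamily T (⋃ i, C i) := by
  constructor
  · intro U hU
    obtain ⟨i, hi⟩ := Set.mem_iUnion.1 hU
    exact (hC i).1 U hi
  · intro U hU V hV hUV
    obtain ⟨i, hi⟩ := Set.mem_iUnion.1 hU
    obtain ⟨j, hj⟩ := Set.mem_iUnion.1 hV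
    by_cases hij : i = j
    · subst hij
      exact (hC i).2 hi hj hUV
    · exact (hd hij).mono (hCO i U hi) (hCO j V hj)

/-- Recursion along a well-order of type `(#ι).ord`: at each stage fewer than `#ι` values are
already taken. -/
theorem exists_injective_choice {ι β : Type u} (S : ι → Set β) (hS : ∀ i, #ι ≤ #(S i)) :
    ∃ g : ι → β, Function.Injective g ∧ ∀ i, g i ∈ S i := by
  classical
  rcases isEmpty_or_nonempty β with hβ | hβ
  · have : IsEmpty ι := by
      by_contra hι
      rw [not_isEmpty_iff] at hι
      obtain ⟨i⟩ := hι
      have := hS i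
      rw [mk_eq_zero (S i), nonpos_iff_eq_zero, mk_eq_zero_iff] at this
      exact this.false i
    exact ⟨isEmptyElim, fun i => isEmptyElim i, isEmptyElim⟩
  let e : ι ≃ (#ι).ord.ToType := Classical.choice (Cardinal.eq.1 (by simp))
  let F : ∀ a : (#ι).ord.ToType, (∀ b, b < a → β) → β := fun a f =>
    if h : ∃ y ∈ S (e.symm a), ∀ b hb, y ≠ f b hb then h.choose else Classical.arbitrary β
  have wf : WellFounded ((· < ·) : (#ι).ord.ToType → (#ι).ord.ToType → Prop) :=
    wellFounded_lt
  let g : (#ι).ord.ToType → β := wf.fix F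
  have hg : ∀ a, g a ∈ S (e.symm a) ∧ ∀ b < a, g a ≠ g b := by
    intro a
    have hex : ∃ y ∈ S (e.symm a), ∀ b, b < a → y ≠ g b := by
      by_contra hcon
      push Not at hcon
      have hsub : S (e.symm a) ⊆ g '' Set.Iio a := fun y hy =>
        let ⟨b, hb, hyb⟩ := hcon y hy
        ⟨b, hb, hyb.symm⟩
      have h1 := (hS (e.symm a)).trans ((mk_le_mk_of_subset hsub).trans mk_image_le)
      exact absurd h1 (not_le.2 (by simpa using mk_Iio_lt a (by simp)))
    have heq : g a = hex.choose := by
      have := wf.fix_eq F a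
      rw [show g a = wf.fix F a from rfl, this]
      exact dif_pos hex
    rw [heq]
    exact hex.choose_spec
  have hne : ∀ a b, a ≠ b → g a ≠ g b := by
    intro a b hab
    rcases lt_or_gt_of_ne hab with h | h
    · exact ((hg b).2 a h).symm
    · exact (hg a).2 b h
  refine ⟨g ∘ e, fun i j hij => ?_, fun i => by simpa using (hg (e i)).1⟩
  by_contra hne'
  exact hne _ _ (e.injective.ne hne') hij

theorem exists_cofinal_family (c : Cardinal.{u}) :
    ∃ (ι : Type u) (f : ι → Cardinal.{u}), #ι = c.ord.cof ∧ (∀ i, f i < c) ∧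
      ∀ ν < c, ∃ i, ν ≤ f i := by
  obtain ⟨s, hs, hcard⟩ := Order.exists_cof_eq c.ord.ToType
  have hlt : ∀ a : c.ord.ToType, #(Set.Iio a) < c := fun a => by
    simpa using mk_Iio_lt a (by simp)
  refine ⟨s, fun i => #(Set.Iio (i : c.ord.ToType)), by rw [hcard, Ordinal.cof_toType],
    fun i => hlt i, fun ν hν => ?_⟩
  let a : c.ord.ToType := Ordinal.ToType.mk ⟨ν.ord, Set.mem_Iio.2 (ord_lt_ord.2 hν)⟩
  have ha : #(Set.Iio a) = ν := by
    have h := congrArg Ordinal.card (Ordinal.type_Iio_lt a)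
    rw [Ordinal.card_type] at h
    have h' : Ordinal.typein (α := c.ord.ToType) (· < ·) a = ν.ord := Ordinal.typein_enum _ _
    rw [h, h', card_ord]
  obtain ⟨b, hb, hab⟩ := hs a
  exact ⟨⟨b, hb⟩, ha.ge.trans (mk_le_mk_of_subset (Set.Iio_subset_Iio hab))⟩

/-- The Erdős–Tarski theorem. -/
theorem not_isSingular_souslinNumber (T : TopologicalSpace X) :
    ¬ (souslinNumber T).IsSingular := by
  intro hsing
  set c := souslinNumber T 
  have hnone : ∀ C : Set (Set X), IsCellularFamily T C → #C < c := fun C hC =>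
    not_le.1 (not_le_mk_of_souslinNumber_le le_rfl hC)
  have hlim := hsing.isSuccLimit
  have hcof := hsing.cof_ord_lt
  obtain ⟨ι, f, hι, hfc, hf⟩ := exists_cofinal_family c
  -- no family of pairwise disjoint sets can carry cellular families of sizes cofinal in `c`
  have hfin : ∀ O : ι → Set X, Pairwise (Function.onFun Disjoint O) →
      ¬ ∀ i, HasCellularFamily T (O i) (f i) := by
    intro O hd hO
    choose C hC hCO hCf using hO
    have h1 := hnone _ (isCellularFamily_iUnion hd hC hCO)
    obtain ⟨i, hi⟩ := hf _ (hlim.succ_lt h1)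
    exact absurd (hi.trans ((hCf i).trans (mk_le_mk_of_subset (Set.subset_iUnion C i))))
      (not_le.2 (Order.lt_succ _))
  let big : Set X → Prop := fun O => ∀ ν < c, HasCellularFamily T O ν
  -- If some open set is hereditarily big, cofinality many disjoint open subsets of it contradict
  -- `hfin`. Otherwise the non-big open sets are dense in the order of open sets, and a maximal
  -- cellular family of them meets every nonempty open set.
  by_cases hA : ∃ O, IsOpen[T] O ∧ O.Nonempty ∧
      ∀ O' ⊆ O, IsOpen[T] O' → O'.Nonempty → big O'
  · obtain ⟨O, hO, hOne, hbig⟩ := hA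
    obtain ⟨C, hC, hCO, hCι⟩ := hbig O subset_rfl hO hOne _ hcof
    rw [← hι, Cardinal.le_def] at hCι
    obtain ⟨g⟩ := hCι
    refine hfin (fun i => (g i : Set X)) (fun i j hij => hC.2 (g i).2 (g j).2 fun h =>
      hij (g.injective (Subtype.ext h))) fun i => ?_
    exact hbig _ (hCO _ (g i).2) (hC.1 _ (g i).2).1 (hC.1 _ (g i).2).2 _ (hfc i)
  push Not at hA
  obtain ⟨𝒜, -, h𝒜⟩ := zorn_subset_nonempty
    {C : Set (Set X) | IsCellularFamily T C ∧ ∀ U ∈ C, ¬ big U}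
    (by
      intro ch hch hchain _
      refine ⟨⋃₀ ch, ⟨⟨?_, ?_⟩, ?_⟩, fun N hN => Set.subset_sUnion_of_mem hN⟩
      · rintro U ⟨N, hN, hU⟩
        exact (hch hN).1.1 U hU
      · exact (Set.pairwise_sUnion hchain.directedOn).2 fun N hN => (hch hN).1.2
      · rintro U ⟨N, hN, hU⟩
        exact (hch hN).2 U hU)
    ∅ ⟨⟨by simp, Set.pairwise_empty _⟩, by simp⟩
  have hmeet : ∀ U, IsOpen[T] U → U.Nonempty → ∃ O ∈ 𝒜, (U ∩ O).Nonempty := by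
    intro U hU hUne
    obtain ⟨O', hO'U, hO', hO'ne, hO'big⟩ := hA U hU hUne
    by_contra hcon
    push Not at hcon
    have hdis : ∀ O ∈ 𝒜, Disjoint O' O := fun O hO =>
      (Set.disjoint_iff_inter_eq_empty.2 (hcon O hO)).mono_left hO'U
    have hmem : O' ∈ 𝒜 := by
      refine h𝒜.le_of_ge (y := insert O' 𝒜) ⟨⟨?_, ?_⟩, ?_⟩ (Set.subset_insert _ _)
        (Set.mem_insert _ _)
      · rintro V (rfl | hV)
        · exact ⟨hO', hO'ne⟩
        · exact h𝒜.prop.1.1 V hV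
      · exact h𝒜.prop.1.2.insert fun V hV _ => ⟨hdis V hV, (hdis V hV).symm⟩
      · rintro V (rfl | hV)
        · exact hO'big
        · exact h𝒜.prop.2 V hV
    exact hO'ne.ne_empty (disjoint_self.1 (hdis O' hmem))
  have h𝒜c : #𝒜 < c := hnone 𝒜 h𝒜.prop.1
  by_cases hB : ∀ ν < c, ∃ O ∈ 𝒜, HasCellularFamily T O ν
  · obtain ⟨g, hginj, hg⟩ := exists_injective_choice
      (fun i => {O ∈ 𝒜 | HasCellularFamily T O (f i)}) (by
        intro i
        -- If fewer than cofinality many members carry `f i` disjoint open sets, their failing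
        -- cardinals have a supremum below `c`; a member carrying more than both that supremum and
        -- `f i` is then impossible.
        by_contra hlt
        rw [hι, not_le] at hlt
        have hb : ∀ O : {O ∈ 𝒜 | HasCellularFamily T O (f i)},
            ∃ ν < c, ¬ HasCellularFamily T (O : Set X) ν := fun O => by
          simpa [big] using h𝒜.prop.2 O O.2.1
        choose ν hνc hν using hb
        have hsup : ⨆ O, ν O < c := iSup_lt_of_lt_cof_ord hlt hνc
        obtain ⟨O, hO, hOP⟩ := hB (max (f i) (⨆ O, ν O)) (max_lt (hfc i) hsup)
        refine hν ⟨O, hO, hOP.mono (le_max_left _ _)⟩ (hOP.mono ?_)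
        exact (le_ciSup bddAbove_of_small _).trans (le_max_right _ _))
    exact hfin g (fun i j hij => h𝒜.prop.1.2 (hg i).1 (hg j).1 (hginj.ne hij)) fun i => (hg i).2
  · push Not at hB
    obtain ⟨ν, hνc, hν⟩ := hB
    have hℵ : ℵ₀ < c := lt_of_le_of_ne hsing.aleph0_le fun h =>
      isRegular_aleph0.not_isSingular (h ▸ hsing)
    -- A cellular family of size ρ⁺ has ρ⁺ members meeting a single member of `𝒜`, as `#𝒜 ≤ ρ`;
    -- their traces there number more than `ν`.
    set ρ := max (max #𝒜 ν) ℵ₀ with hρ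
    have hρc : Order.succ ρ < c := hlim.succ_lt (max_lt (max_lt h𝒜c hνc) hℵ)
    obtain ⟨C, hC, hCcard⟩ := exists_isCellularFamily_of_lt hρc
    have hreg : (Order.succ ρ).IsRegular := isRegular_succ (le_max_right _ _)
    choose φ hφ hφne using fun U : C => hmeet U (hC.1 U U.2).1 (hC.1 U U.2).2
    obtain ⟨O, hO⟩ := infinite_pigeonhole_card (fun U : C => (⟨φ U, hφ U⟩ : 𝒜)) (Order.succ ρ)
      hCcard.ge hreg.1 (by
        rw [hreg.cof_ord]
        exact Order.lt_succ_of_le ((le_max_left _ _).trans (le_max_left _ _)))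
    have hO' : ∀ U : (fun U : C => (⟨φ U, hφ U⟩ : 𝒜)) ⁻¹' {O}, φ U = O := fun U =>
      congrArg Subtype.val U.2
    obtain ⟨hcell, hcard⟩ := isCellularFamily_range (T := T)
      (O := fun U : (fun U : C => (⟨φ U, hφ U⟩ : 𝒜)) ⁻¹' {O} => (U.1.1 ∩ O.1 : Set X))
      (fun U => (hC.1 _ U.1.2).1.inter (h𝒜.prop.1.1 _ O.2).1)
      (fun U => by
        have := hφne U
        rwa [hO' U] at this)
      (fun U V hUV => (hC.2 U.1.2 V.1.2 fun h => hUV (Subtype.ext (Subtype.ext h))).mono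
        Set.inter_subset_left Set.inter_subset_left)
    refine hν O O.2 ⟨_, hcell, ?_, ?_⟩
    · rintro _ ⟨U, rfl⟩
      exact Set.inter_subset_right
    · rw [hcard]
      exact ((le_max_right _ _).trans (le_max_left _ _)).trans ((Order.le_succ ρ).trans hO)

end Souslin
-- Adding clopen sets to a topology.
section Expansion

variable {X K : Type u}

open Classical in
/-- The coarsest topology finer than `T` in which all the sets `B k` are clopen. -/
@[reducible]
noncomputable def clopenExpansion (T : TopologicalSpace X) (B : K → Set X) :
    TopologicalSpace X :=
  T ⊓ ⨅ k, TopologicalSpace.induced (fun x => decide (x ∈ B k)) inferInstance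

theorem clopenExpansion_le (T : TopologicalSpace X) (B : K → Set X) : clopenExpansion T B ≤ T :=
  inf_le_left

theorem t35Space_clopenExpansion {T : TopologicalSpace X} (hT : @T35Space X T) (B : K → Set X) :
    @T35Space X (clopenExpansion T B) := by
  have h0 : @T0Space X (clopenExpansion T B) :=
    @t0Space_of_injective_of_continuous X X (clopenExpansion T B) T id
      Function.injective_id (continuous_id_of_le (clopenExpansion_le T B)) hT.toT0Space
  have h1 : @CompletelyRegularSpace X (clopenExpansion T B) :=
    completelyRegularSpace_inf hT.toCompletelyRegularSpace
      (completelyRegularSpace_iInf fun k => completelyRegularSpace_induced inferInstance _)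
  exact @T35Space.mk X (clopenExpansion T B) h0 h1

theorem isOpen_clopenExpansion_mem_iff (T : TopologicalSpace X) (B : K → Set X) (k : K)
    (p : Prop) : IsOpen[clopenExpansion T B] {x | x ∈ B k ↔ p} := by
  classical
  have h : clopenExpansion T B ≤
      TopologicalSpace.induced (fun x => decide (x ∈ B k)) inferInstance :=
    inf_le_right.trans (iInf_le _ k)
  refine h _ (isOpen_induced_iff.2 ⟨{decide p}, isOpen_discrete _, ?_⟩)
  ext x
  simp

theorem isOpen_inter_patternSet {T : TopologicalSpace X} {O : Set X} (hO : IsOpen[T] O)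
    (B : K → Set X) (s : Finset K) (e : Set K) :
    IsOpen[clopenExpansion T B] (O ∩ patternSet B s e) := by
  let _ : TopologicalSpace X := clopenExpansion T B
  have : patternSet B s e = ⋂ k ∈ s, {x | x ∈ B k ↔ k ∈ e} := by
    ext x
    simp [patternSet]
  rw [this]
  exact IsOpen.inter (clopenExpansion_le T B O hO)
    (isOpen_biInter_finset fun k _ => isOpen_clopenExpansion_mem_iff T B k _)

/-- The sets `O ∩ patternSet B s e` form a base of `clopenExpansion T B`. -/
theorem exists_inter_patternSet_subset {T : TopologicalSpace X} {B : K → Set X} {G : Set X}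
    (hG : IsOpen[clopenExpansion T B] G) {x : X} (hx : x ∈ G) :
    ∃ (O : Set X) (s : Finset K) (e : Set K), IsOpen[T] O ∧ x ∈ O ∩ patternSet B s e ∧
      O ∩ patternSet B s e ⊆ G := by
  classical
  have hmem : G ∈ @nhds X (clopenExpansion T B) x := @IsOpen.mem_nhds X (clopenExpansion T B) x G hG hx
  rw [clopenExpansion, nhds_inf, nhds_iInf] at hmem
  obtain ⟨G₁, hG₁, G₂, hG₂, rfl⟩ := Filter.mem_inf_iff.1 hmem
  obtain ⟨s, hs, g, hg, rfl⟩ := Filter.mem_iInf.1 hG₂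
  obtain ⟨O, hOG, hO, hxO⟩ := (@mem_nhds_iff X T x G₁).1 hG₁
  refine ⟨O, hs.toFinset, {k | x ∈ B k}, hO, ⟨hxO, fun k _ => Iff.rfl⟩, ?_⟩
  rintro y ⟨hyO, hy⟩
  refine ⟨hOG hyO, Set.mem_iInter.2 fun k => ?_⟩
  have hgk := hg k
  rw [nhds_induced, nhds_discrete, Filter.mem_comap] at hgk
  obtain ⟨D, hD, hDg⟩ := hgk
  refine hDg ?_
  have hxy : decide (y ∈ B k) = decide (x ∈ B k) := by
    simpa using hy k (hs.mem_toFinset.2 k.2)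
  rw [Set.mem_preimage, hxy]
  exact Filter.mem_pure.1 hD

theorem dense_clopenExpansion {T : TopologicalSpace X} {B : K → Set X} {E : Set X}
    (h : ∀ (O : Set X) (s : Finset K) (e : Set K), IsOpen[T] O →
      (O ∩ patternSet B s e).Nonempty → (O ∩ patternSet B s e ∩ E).Nonempty) :
    @Dense X (clopenExpansion T B) E := by
  refine (@dense_iff_inter_open X (clopenExpansion T B) E).2 fun G hG hne => ?_
  obtain ⟨x, hx⟩ := hne
  obtain ⟨O, s, e, hO, hxO, hsub⟩ := exists_inter_patternSet_subset hG hx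
  exact (h O s e hO ⟨x, hxO⟩).mono (Set.inter_subset_inter_left E hsub)

end Expansion

/-! ### Transferring independent functions to a maximally resolvable space. -/

section Independence

variable {X : Type u} {T : TopologicalSpace X}

/-- A maximally resolvable space carries `2 ^ Δ(X)` many functions with values in a set of
size `Δ(X)` that are independent on every nonempty open set, with large witness sets. -/
theorem exists_independent_functions_of_isMaximallyResolvable
    (hmax : IsMaximallyResolvable T) {V Γ : Type u} [Infinite V]
    (hV : #V = dispersionCharacter T) (hΓ : #Γ ≤ 2 ^ #V) :
    ∃ H : Γ → X → Option V, ∀ (O : Set X), IsOpen[T] O → O.Nonempty →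
      ∀ (s : Finset Γ) (v : Γ → Option V), #V ≤ #(O ∩ {x | ∀ γ ∈ s, H γ x = v γ} : Set X) := by
  classical
  obtain ⟨I, h, hI, hind⟩ := exists_independent_functions V
  obtain ⟨𝒟, h𝒟, hdense, hdisj⟩ := hmax
  have hcard : #(I × V) = #𝒟 := by
    rw [mk_prod, lift_id, lift_id, hI, mul_eq_self (aleph0_le_mk V), h𝒟, hV]
  obtain ⟨σ⟩ := Cardinal.eq.1 hcard
  have hIne : Nonempty I := (hind ∅ fun _ => none).nonempty
  let p : X → I := fun x =>
    if hx : ∃ D : 𝒟, x ∈ (D : Set X) then (σ.symm hx.choose).1 else Classical.arbitrary I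
  have huniq : ∀ {x : X} {D E : 𝒟}, x ∈ (D : Set X) → x ∈ (E : Set X) → D = E := by
    intro x D E hD hE
    by_contra hne
    exact Set.disjoint_left.1 (hdisj D.2 E.2 fun h => hne (Subtype.ext h)) hD hE
  have hp : ∀ (i : I) (v : V) (x : X), x ∈ (σ (i, v) : Set X) → p x = i := by
    intro i v x hx
    have hex : ∃ D : 𝒟, x ∈ (D : Set X) := ⟨_, hx⟩
    have : p x = (σ.symm hex.choose).1 := dif_pos hex
    rw [this, huniq hex.choose_spec hx, Equiv.symm_apply_apply]
  rw [← mk_set, Cardinal.le_def] at hΓ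
  obtain ⟨j⟩ := hΓ
  refine ⟨fun γ x => h (j γ) (p x), fun O hO hOne s v => ?_⟩
  obtain ⟨i, hi⟩ := hind (s.map j) (Function.extend j v fun _ => none)
  -- All the disjoint dense sets `σ (i, w)` lie over the same `i`, so each contributes its own
  -- witness in `O`.
  choose y hyO hyD using fun w : V =>
    @Dense.inter_open_nonempty X T _ (hdense _ (σ (i, w)).2) O hO hOne
  refine mk_le_of_injective (f := fun w : V =>
    (⟨y w, hyO w, fun γ hγ => ?_⟩ : (O ∩ {x | ∀ γ ∈ s, h (j γ) (p x) = v γ} : Set X))) ?_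
  · rw [hp i w (y w) (hyD w), hi _ (Finset.mem_map_of_mem j hγ), j.injective.extend_apply]
  · intro w w' hww
    have h1 : y w = y w' := congrArg Subtype.val hww
    have h2 := hyD w'
    rw [← h1] at h2
    have := σ.injective (huniq (hyD w) h2)
    exact congrArg Prod.snd this

end Independence

/-! ### Cells and the construction of the controlled expansion. -/

section Cells

variable {X M V P : Type u}

/-- A finite amount of information on a point: membership in `O`, the values `a` of the labelling
functions with index in `t`, and membership in the clopen sets with index in `s`. -/
structure Cell (X M V P : Type u) where
  O : Set X
  t : Finset M
  a : M → V
  s : Finset (P ⊕ M × M × ℕ)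
  e : Set (P ⊕ M × M × ℕ)

def labelSet (L : M → X → Option V) (t : Finset M) (a : M → V) : Set X :=
  {x | ∀ m ∈ t, L m x = some (a m)}

def labelUnion (L : M → X → Option V) (R : M → Set V) (m : M) : Set X :=
  {x | ∃ r ∈ R m, L m x = some r}

def Cell.carrier (c : Cell X M V P) (L : M → X → Option V) (B : P ⊕ M × M × ℕ → Set X) : Set X :=
  c.O ∩ labelSet L c.t c.a ∩ patternSet B c.s c.e

/-- A cell is admissible if its labels are among the permitted ones and if it does not require,
for two labelling functions that it uses, that the point avoids one of the clopen sets which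
are to contain all points permissibly labelled by both. -/
structure Cell.IsAdmissible (c : Cell X M V P) (T : TopologicalSpace X) (R : M → Set V) :
    Prop where
  isOpen : IsOpen[T] c.O
  nonempty : c.O.Nonempty
  mem : ∀ m ∈ c.t, c.a m ∈ R m
  pair : ∀ m m' n, Sum.inr (m, m', n) ∈ c.s → m ≠ m' → m ∈ c.t → m' ∈ c.t →
    Sum.inr (m, m', n) ∈ c.e

/-- The labelling `L` and the clopen sets `B` are such that admissible cells are large, points
permissibly labelled by two functions lie in the corresponding clopen sets, and dense sets
of the expansion contain an admissible cell up to fewer than `κ` points. -/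
structure IsControlled (T : TopologicalSpace X) (κ : Cardinal.{u}) (R : M → Set V)
    (L : M → X → Option V) (B : P ⊕ M × M × ℕ → Set X) : Prop where
  large : ∀ c : Cell X M V P, c.IsAdmissible T R → κ ≤ #(c.carrier L B)
  pair : ∀ m m' n, m ≠ m' → labelUnion L R m ∩ labelUnion L R m' ⊆ B (Sum.inr (m, m', n))
  forced : ∀ E : Set X, @Dense X (clopenExpansion T B) E →
    ∃ c : Cell X M V P, c.IsAdmissible T R ∧ #(c.carrier L B \ E : Set X) < κ

/-- Taking `W` of size `#V` leaves only `2 ^ #V` subsets of `W` to be handled, so the independent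
functions suffice to give each its own clopen set. -/
theorem exists_isControlled {T : TopologicalSpace X} (hmax : IsMaximallyResolvable T)
    [Infinite V] (hV : #V = dispersionCharacter T) (hM : #M ≤ 2 ^ #V) (R : M → Set V)
    {W : Set X} (hW : IsOpen[T] W) (hWne : W.Nonempty) (hWV : #W = #V) :
    ∃ (L : M → X → Option V) (B : Set W ⊕ M × M × ℕ → Set X), IsControlled T #V R L B := by
  classical
  have hinf : ℵ₀ ≤ (2 : Cardinal.{u}) ^ #V := (aleph0_le_mk V).trans (cantor _).le
  have hΓ : #(M ⊕ (Set W ⊕ M × M × ℕ)) ≤ 2 ^ #V := by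
    have h1 : #(M × M × ℕ) ≤ 2 ^ #V := by
      simp only [mk_prod, lift_id, lift_uzero, mk_nat, lift_aleph0]
      exact mul_le_of_le hinf hM (mul_le_of_le hinf hM hinf)
    rw [mk_sum, mk_sum, lift_id, lift_id, lift_id, lift_id, mk_set, hWV]
    exact add_le_of_le hinf hM (add_le_of_le hinf le_rfl h1)
  obtain ⟨H, hH⟩ := exists_independent_functions_of_isMaximallyResolvable hmax hV hΓ
  let v₀ : V := Classical.arbitrary V
  let L : M → X → Option V := fun m => H (Sum.inl m)
  let B₀ : Set W ⊕ M × M × ℕ → Set X := fun k =>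
    {x | H (Sum.inr k) x = some v₀ ∨
      ∃ m m' n, k = Sum.inr (m, m', n) ∧ m ≠ m' ∧ x ∈ labelUnion L R m ∩ labelUnion L R m'}
  let A : Set W ⊕ M × M × ℕ → Set X := Sum.elim (fun S => Subtype.val '' S) fun _ => ∅
  obtain ⟨N, hN, hN'⟩ := exists_maximal_pruning B₀ A #V
    {q | ∃ c : Cell X M V (Set W), c.IsAdmissible T R ∧
      q = (c.O ∩ labelSet L c.t c.a, c.s, c.e)} (by
    rintro _ ⟨c, hc, rfl⟩
    -- Labellings mentioned by a pair index but not used in `c.t` are given the value `none`. A pair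
    -- set is then forced only when both of its labellings lie in `c.t`, which is the case that
    -- admissibility covers.
    let ment : Finset M := c.s.biUnion (Sum.elim (fun _ => ∅) fun q => {q.1, q.2.1})
    let s : Finset (M ⊕ (Set W ⊕ M × M × ℕ)) :=
      (c.t ∪ ment).image Sum.inl ∪ c.s.image Sum.inr
    let v : M ⊕ (Set W ⊕ M × M × ℕ) → Option V := Sum.elim
      (fun m => if m ∈ c.t then some (c.a m) else none)
      (fun k => if k ∈ c.e then some v₀ else none)
    refine (hH c.O hc.isOpen hc.nonempty s v).trans (mk_le_mk_of_subset ?_)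
    rintro x ⟨hxO, hx⟩
    have hxm : ∀ m ∈ c.t ∪ ment, L m x = if m ∈ c.t then some (c.a m) else none := fun m hm =>
      hx (Sum.inl m) (Finset.mem_union_left _ (Finset.mem_image_of_mem _ hm))
    have hxk : ∀ k ∈ c.s, H (Sum.inr k) x = if k ∈ c.e then some v₀ else none := fun k hk =>
      hx (Sum.inr k) (Finset.mem_union_right _ (Finset.mem_image_of_mem _ hk))
    refine ⟨⟨hxO, fun m hm => ?_⟩, fun k hk => ?_⟩
    · rw [hxm m (Finset.mem_union_left _ hm), if_pos hm]
    · have h1 := hxk k hk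
      by_cases hke : k ∈ c.e
      · rw [if_pos hke] at h1
        exact iff_of_true (Or.inl h1) hke
      · rw [if_neg hke] at h1
        refine iff_of_false ?_ hke
        rintro (h2 | ⟨m, m', n, rfl, hne, ⟨r, -, hr⟩, ⟨r', -, hr'⟩⟩)
        · rw [h1] at h2
          exact Option.some_ne_none _ h2.symm
        · have hm : m ∈ ment := Finset.mem_biUnion.2 ⟨_, hk, by simp⟩
          have hm' : m' ∈ ment := Finset.mem_biUnion.2 ⟨_, hk, by simp⟩
          rw [hxm m (Finset.mem_union_right _ hm)] at hr
          rw [hxm m' (Finset.mem_union_right _ hm')] at hr'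
          refine hke (hc.pair m m' n hk hne ?_ ?_)
          · by_contra hmt
            rw [if_neg hmt] at hr
            exact Option.some_ne_none _ hr.symm
          · by_contra hmt
            rw [if_neg hmt] at hr'
            exact Option.some_ne_none _ hr'.symm)
  have hlarge : ∀ c : Cell X M V (Set W), c.IsAdmissible T R →
      #V ≤ #(c.carrier L (pruned B₀ A N)) := fun c hc => hN _ ⟨c, hc, rfl⟩
  refine ⟨L, pruned B₀ A N, hlarge, ?_, fun E hE => ?_⟩
  · intro m m' n hne x hx
    exact ⟨Or.inr ⟨m, m', n, rfl, hne, hx⟩, fun _ => Set.notMem_empty x⟩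
  · let S : Set W := {x | (x : X) ∈ E}
    have hSE : A (Sum.inl S) ⊆ E := by
      rintro _ ⟨x, hx, rfl⟩
      exact hx
    by_cases hS : Sum.inl S ∈ N
    -- Here the trace of `E` was removed, so the clopen set of `S` meets `W` in a nonempty open set
    -- disjoint from `E`.
    · exfalso
      let c : Cell X M V (Set W) :=
        ⟨W, ∅, fun _ => v₀, {Sum.inl S}, {Sum.inl S}⟩
      have hc : c.IsAdmissible T R := ⟨hW, hWne, by simp [c], by simp [c]⟩
      have hne : (c.carrier L (pruned B₀ A N)).Nonempty := by
        rw [← Set.nonempty_coe_sort, ← mk_ne_zero_iff]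
        exact (lt_of_lt_of_le (aleph0_pos.trans_le (aleph0_le_mk V)) (hlarge c hc)).ne'
      obtain ⟨x, ⟨hxW, -⟩, hx⟩ := hne
      obtain ⟨y, ⟨hyW, hy⟩, hyE⟩ := @Dense.inter_open_nonempty X (clopenExpansion T _) _ hE _
        (isOpen_inter_patternSet hW (pruned B₀ A N) c.s c.e) ⟨x, hxW, hx⟩
      have := (hy (Sum.inl S) (by simp [c])).2 (by simp [c])
      exact this.2 hS ⟨⟨y, hyW⟩, hyE, rfl⟩
    · obtain ⟨_, ⟨c, hc, rfl⟩, hlt⟩ := hN' _ hS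
      exact ⟨c, hc, (mk_le_mk_of_subset (Set.sdiff_subset_sdiff_right hSE)).trans_lt hlt⟩

end Cells
-- Topological consequences of control.
section Controlled

variable {X M V P : Type u} {T : TopologicalSpace X} {κ : Cardinal.{u}} {R : M → Set V}
  {L : M → X → Option V} {B : P ⊕ M × M × ℕ → Set X}

theorem le_mk_inter_of_mk_sdiff_lt (hκ : ℵ₀ ≤ κ) {S E F : Set X} (hS : κ ≤ #S)
    (hE : #(S \ E : Set X) < κ) (hF : #(S \ F : Set X) < κ) : κ ≤ #(S ∩ (E ∩ F) : Set X) := by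
  by_contra hlt
  push Not at hlt
  have hsub : S ⊆ (S ∩ (E ∩ F)) ∪ ((S \ E) ∪ (S \ F)) := by
    intro x hx
    by_cases h1 : x ∈ E
    · by_cases h2 : x ∈ F
      · exact Or.inl ⟨hx, h1, h2⟩
      · exact Or.inr (Or.inr ⟨hx, h2⟩)
    · exact Or.inr (Or.inl ⟨hx, h1⟩)
  refine absurd (hS.trans (mk_le_mk_of_subset hsub)) (not_le.2 ?_)
  refine (mk_union_le _ _).trans_lt (add_lt_of_lt hκ hlt ?_)
  exact (mk_union_le _ _).trans_lt (add_lt_of_lt hκ hE hF)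

/-- Among regularly and uncountably many admissible cells, two contain a common admissible
cell. -/
theorem exists_isAdmissible_carrier_subset {μ : Cardinal.{u}} (hμ : μ.IsRegular) (hμ' : ℵ₀ < μ)
    (hT : souslinNumber T ≤ μ) (hR : ∀ m, #(R m) < μ) {ι : Type u} (hι : μ ≤ #ι)
    (c : ι → Cell X M V P) (hc : ∀ i, (c i).IsAdmissible T R)
    (L : M → X → Option V) (B : P ⊕ M × M × ℕ → Set X) :
    ∃ i j, i ≠ j ∧ ∃ d : Cell X M V P, d.IsAdmissible T R ∧
      d.carrier L B ⊆ (c i).carrier L B ∩ (c j).carrier L B := by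
  classical
  -- The domains include the mentioned labellings, with `none` recorded when unused. Compatibility
  -- then ensures that a labelling mentioned by one cell and used by the other is used by both, so
  -- the union of the two cells satisfies the pair condition.
  let ment : ι → Finset M := fun i =>
    (c i).s.biUnion (Sum.elim (fun _ => ∅) fun q => {q.1, q.2.1})
  let u : ι → Finset (M ⊕ (P ⊕ M × M × ℕ)) := fun i =>
    ((c i).t ∪ ment i).image Sum.inl ∪ (c i).s.image Sum.inr
  let w : ι → M ⊕ (P ⊕ M × M × ℕ) → Option V ⊕ ULift.{u} Prop := fun i => Sum.elim
    (fun m => Sum.inl (if m ∈ (c i).t then some ((c i).a m) else none))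
    (fun k => Sum.inr ⟨k ∈ (c i).e⟩)
  let Q : M ⊕ (P ⊕ M × M × ℕ) → Set (Option V ⊕ ULift.{u} Prop) := Sum.elim
    (fun m => insert (Sum.inl none) ((fun r => Sum.inl (some r)) '' R m))
    (fun _ => Set.range Sum.inr)
  obtain ⟨J, hJ, hcomp⟩ := exists_compatible_subfamily hμ hμ' u w Q
    (by
      rintro i (m | k) _
      · change Sum.inl (if m ∈ (c i).t then some ((c i).a m) else none) ∈ insert _ _
        by_cases hm : m ∈ (c i).t
        · rw [if_pos hm]
          exact Or.inr ⟨_, (hc i).mem m hm, rfl⟩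
        · rw [if_neg hm]
          exact Or.inl rfl
      · exact ⟨_, rfl⟩)
    (by
      rintro (m | k)
      · refine (mk_insert_le).trans_lt (add_lt_of_lt hμ.1 (mk_image_le.trans_lt (hR m)) ?_)
        exact one_lt_aleph0.trans hμ'
      · refine mk_range_le.trans_lt (lt_of_lt_of_le (lt_aleph0_of_finite _) hμ.1)) hι
  have hmeet : ∃ i ∈ J, ∃ j ∈ J, i ≠ j ∧ ((c i).O ∩ (c j).O).Nonempty := by
    by_contra hcon
    push Not at hcon
    obtain ⟨h1, h2⟩ := isCellularFamily_range (T := T) (O := fun i : J => (c i).O)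
      (fun i => (hc i).isOpen) (fun i => (hc i).nonempty) fun i j hij =>
        Set.disjoint_iff_inter_eq_empty.2 (hcon i i.2 j j.2 fun h => hij (Subtype.ext h))
    exact not_le_mk_of_souslinNumber_le hT h1 (hJ.trans h2.ge)
  obtain ⟨i, hi, j, hj, hij, hO⟩ := hmeet
  have hwm : ∀ m ∈ (c i).t ∪ ment i, m ∈ (c j).t ∪ ment j →
      (if m ∈ (c i).t then some ((c i).a m) else none) =
        if m ∈ (c j).t then some ((c j).a m) else none := fun m hmi hmj =>
    Sum.inl_injective (hcomp i hi j hj (Sum.inl m)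
      (Finset.mem_union_left _ (Finset.mem_image_of_mem _ hmi))
      (Finset.mem_union_left _ (Finset.mem_image_of_mem _ hmj)))
  have hwk : ∀ k ∈ (c i).s, k ∈ (c j).s → (k ∈ (c i).e ↔ k ∈ (c j).e) := fun k hki hkj =>
    iff_of_eq (congrArg ULift.down (Sum.inr_injective (hcomp i hi j hj (Sum.inr k)
      (Finset.mem_union_right _ (Finset.mem_image_of_mem _ hki))
      (Finset.mem_union_right _ (Finset.mem_image_of_mem _ hkj)))))
  have hti : ∀ m ∈ (c i).t ∪ ment i, m ∈ (c j).t → m ∈ (c i).t := by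
    intro m hmi hmj
    have := hwm m hmi (Finset.mem_union_left _ hmj)
    rw [if_pos hmj] at this
    by_contra hm
    rw [if_neg hm] at this
    exact Option.some_ne_none _ this.symm
  have htj : ∀ m ∈ (c j).t ∪ ment j, m ∈ (c i).t → m ∈ (c j).t := by
    intro m hmj hmi
    have := hwm m (Finset.mem_union_left _ hmi) hmj
    rw [if_pos hmi] at this
    by_contra hm
    rw [if_neg hm] at this
    exact Option.some_ne_none _ this
  have hment : ∀ l m m' n, Sum.inr (m, m', n) ∈ (c l).s → m ∈ ment l ∧ m' ∈ ment l :=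
    fun l m m' n h => ⟨Finset.mem_biUnion.2 ⟨_, h, by simp⟩, Finset.mem_biUnion.2 ⟨_, h, by simp⟩⟩
  let d : Cell X M V P :=
    { O := (c i).O ∩ (c j).O
      t := (c i).t ∪ (c j).t
      a := fun m => if m ∈ (c i).t then (c i).a m else (c j).a m
      s := (c i).s ∪ (c j).s
      e := {k | (k ∈ (c i).s ∧ k ∈ (c i).e) ∨ (k ∈ (c j).s ∧ k ∈ (c j).e)} }
  refine ⟨i, j, hij, d, ⟨?_, hO, ?_, ?_⟩, ?_⟩
  · exact @IsOpen.inter X T _ _ (hc i).isOpen (hc j).isOpen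
  · intro m hm
    change (if m ∈ (c i).t then (c i).a m else (c j).a m) ∈ R m
    by_cases hmi : m ∈ (c i).t
    · rw [if_pos hmi]
      exact (hc i).mem m hmi
    · rw [if_neg hmi]
      exact (hc j).mem m ((Finset.mem_union.1 hm).resolve_left hmi)
  · intro m m' n hk hne hm hm'
    rcases Finset.mem_union.1 hk with hk | hk
    · obtain ⟨h1, h2⟩ := hment i m m' n hk
      refine Or.inl ⟨hk, (hc i).pair m m' n hk hne ?_ ?_⟩
      · exact (Finset.mem_union.1 hm).elim id (hti m (Finset.mem_union_right _ h1))
      · exact (Finset.mem_union.1 hm').elim id (hti m' (Finset.mem_union_right _ h2))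
    · obtain ⟨h1, h2⟩ := hment j m m' n hk
      refine Or.inr ⟨hk, (hc j).pair m m' n hk hne ?_ ?_⟩
      · exact (Finset.mem_union.1 hm).elim (htj m (Finset.mem_union_right _ h1)) id
      · exact (Finset.mem_union.1 hm').elim (htj m' (Finset.mem_union_right _ h2)) id
  · rintro x ⟨⟨⟨hxi, hxj⟩, hxt⟩, hxs⟩
    refine ⟨⟨⟨hxi, fun m hm => ?_⟩, fun k hk => ?_⟩, ⟨hxj, fun m hm => ?_⟩, fun k hk => ?_⟩
    · rw [hxt m (Finset.mem_union_left _ hm)]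
      exact congrArg some (if_pos hm)
    · rw [hxs k (Finset.mem_union_left _ hk)]
      refine ⟨?_, fun h => Or.inl ⟨hk, h⟩⟩
      rintro (⟨-, h⟩ | ⟨hkj, h⟩)
      · exact h
      · exact (hwk k hk hkj).2 h
    · rw [hxt m (Finset.mem_union_right _ hm)]
      by_cases hmi : m ∈ (c i).t
      · have := hwm m (Finset.mem_union_left _ hmi) (Finset.mem_union_left _ hm)
        rw [if_pos hmi, if_pos hm] at this
        exact (congrArg some (if_pos hmi)).trans this
      · exact congrArg some (if_neg hmi)
    · rw [hxs k (Finset.mem_union_right _ hk)]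
      refine ⟨?_, fun h => Or.inr ⟨hk, h⟩⟩
      rintro (⟨hki, h⟩ | ⟨-, h⟩)
      · exact (hwk k hki hk).1 h
      · exact h

namespace IsControlled

theorem nonempty_carrier (h : IsControlled T κ R L B) (hκ : ℵ₀ ≤ κ) {c : Cell X M V P}
    (hc : c.IsAdmissible T R) : (c.carrier L B).Nonempty := by
  rw [← Set.nonempty_coe_sort, ← mk_ne_zero_iff]
  exact ((aleph0_pos.trans_le hκ).trans_le (h.large c hc)).ne'

theorem le_mk_of_isOpen [Nonempty V] (h : IsControlled T κ R L B) {G : Set X}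
    (hG : IsOpen[clopenExpansion T B] G) (hne : G.Nonempty) : κ ≤ #G := by
  obtain ⟨x, hx⟩ := hne
  obtain ⟨O, s, e, hO, hxO, hsub⟩ := exists_inter_patternSet_subset hG hx
  have v : V := Classical.arbitrary V
  refine (h.large ⟨O, ∅, fun _ => v, s, e⟩ ⟨hO, ⟨x, hxO.1⟩, by simp, by simp⟩).trans
    (mk_le_mk_of_subset (Set.Subset.trans ?_ hsub))
  exact fun y hy => ⟨hy.1.1, hy.2⟩

theorem dispersionCharacter_eq [Nonempty V] (h : IsControlled T κ R L B) {W : Set X}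
    (hW : IsOpen[T] W) (hWne : W.Nonempty) (hWκ : #W = κ) :
    dispersionCharacter (clopenExpansion T B) = κ := by
  have hmem : κ ∈ {c | ∃ U : Set X, IsOpen[clopenExpansion T B] U ∧ U.Nonempty ∧ #U = c} :=
    ⟨W, clopenExpansion_le T B W hW, hWne, hWκ⟩
  refine le_antisymm (csInf_le' hmem) (le_csInf ⟨κ, hmem⟩ ?_)
  rintro _ ⟨U, hU, hUne, rfl⟩
  exact h.le_mk_of_isOpen hU hUne

/-- A disjoint family of size μ would give label-free cells, two of which contain a common
admissible cell; largeness makes that cell nonempty. -/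
theorem souslinNumber_le [Nonempty V] (h : IsControlled T κ R L B) (hκ : ℵ₀ ≤ κ)
    {μ : Cardinal.{u}} (hμ : μ.IsRegular) (hμ' : ℵ₀ < μ) (hT : souslinNumber T ≤ μ) :
    souslinNumber (clopenExpansion T B) ≤ μ := by
  refine souslinNumber_le_of_forall fun C hC hCμ => ?_
  choose O s e hO hx hsub using fun U : C =>
    exists_inter_patternSet_subset (hC.1 U U.2).1 (hC.1 U U.2).2.some_mem
  have v : V := Classical.arbitrary V
  -- the cells use no labels, so the bound on the number of permitted labels is irrelevant
  have hadm : ∀ U : C, (⟨O U, ∅, fun _ => v, s U, e U⟩ : Cell X M V P).IsAdmissible T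
      fun _ => ∅ := fun U => ⟨hO U, ⟨_, (hx U).1⟩, by simp, by simp⟩
  obtain ⟨U, U', hne, d, hd, hdsub⟩ := exists_isAdmissible_carrier_subset hμ hμ' hT
    (by intro m; simpa using hμ.pos) hCμ.ge _ hadm L B
  have hd' : d.IsAdmissible T R :=
    ⟨hd.isOpen, hd.nonempty, fun m hm => (hd.mem m hm).elim, hd.pair⟩
  obtain ⟨y, hy⟩ := h.nonempty_carrier hκ hd'
  obtain ⟨hy1, hy2⟩ := hdsub hy
  exact Set.disjoint_left.1 (hC.2 U.2 U'.2 fun h => hne (Subtype.ext h))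
    (hsub U ⟨hy1.1.1, hy1.2⟩) (hsub U' ⟨hy2.1.1, hy2.2⟩)

theorem dense_label (h : IsControlled T κ R L B) (hκ : ℵ₀ ≤ κ) {m : M} {r : V} (hr : r ∈ R m) :
    @Dense X (clopenExpansion T B) {x | L m x = some r} := by
  refine dense_clopenExpansion fun O s e hO hne => ?_
  have hadm : (⟨O, {m}, fun _ => r, s, e⟩ : Cell X M V P).IsAdmissible T R := by
    refine ⟨hO, hne.left, fun m' hm' => ?_, fun m₁ m₂ n _ hne hm₁ hm₂ => ?_⟩
    · rw [Finset.mem_singleton.1 hm']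
      exact hr
    · exact absurd ((Finset.mem_singleton.1 hm₁).trans (Finset.mem_singleton.1 hm₂).symm) hne
  obtain ⟨y, hy⟩ := h.nonempty_carrier hκ hadm
  exact ⟨y, ⟨hy.1.1, hy.2⟩, hy.1.2 m (Finset.mem_singleton_self m)⟩

/-- A basic open set mentions finitely many indices, so for some unmentioned `n` it can be shrunk to
a nonempty open set avoiding `B (Sum.inr (m, m', n))`, which contains the whole intersection. -/
theorem isNowhereDense_inter [Nonempty V] (h : IsControlled T κ R L B) (hκ : ℵ₀ ≤ κ) {m m' : M}
    (hne : m ≠ m') :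
    @IsNowhereDense X (clopenExpansion T B) (labelUnion L R m ∩ labelUnion L R m') := by
  classical
  let _ : TopologicalSpace X := clopenExpansion T B
  rw [IsNowhereDense, Set.eq_empty_iff_forall_notMem]
  intro x hx
  obtain ⟨O, s, e, hO, hxO, hsub⟩ := exists_inter_patternSet_subset isOpen_interior hx
  obtain ⟨n, hn⟩ : ∃ n : ℕ, Sum.inr (m, m', n) ∉ s :=
    (Set.infinite_range_of_injective (f := fun n : ℕ => (Sum.inr (m, m', n) : P ⊕ M × M × ℕ))
      fun a b hab => by simpa using hab).exists_notMem_finset s |>.elim fun k hk => by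
        obtain ⟨⟨n, rfl⟩, hk⟩ := hk
        exact ⟨n, hk⟩
  set k : P ⊕ M × M × ℕ := Sum.inr (m, m', n)
  obtain ⟨v⟩ := ‹Nonempty V›
  have hadm : (⟨O, ∅, fun _ => v, insert k s, e \ {k}⟩ : Cell X M V P).IsAdmissible T R :=
    ⟨hO, ⟨x, hxO.1⟩, by simp, by simp⟩
  obtain ⟨y, hy⟩ := h.nonempty_carrier hκ hadm
  have hyG : y ∈ O ∩ patternSet B (insert k s) (e \ {k}) := ⟨hy.1.1, hy.2⟩
  have hycl : y ∈ closure (labelUnion L R m ∩ labelUnion L R m') := by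
    refine interior_subset (hsub ⟨hyG.1, fun l hl => ?_⟩)
    rw [hyG.2 l (Finset.mem_insert_of_mem hl)]
    have hlk : l ≠ k := by
      rintro rfl
      exact hn hl
    simp [hlk]
  obtain ⟨z, hzG, hz⟩ := mem_closure_iff.1 hycl _ (isOpen_inter_patternSet hO B _ _) hyG
  exact ((hzG.2 k (Finset.mem_insert_self k s)).1 (h.pair m m' n hne hz)).2 rfl

/-- Two of regularly and uncountably many dense sets meet in almost all points of some
admissible cell. -/
theorem exists_isAdmissible_of_dense (h : IsControlled T κ R L B) (hκ : ℵ₀ ≤ κ)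
    {μ : Cardinal.{u}} (hμ : μ.IsRegular) (hμ' : ℵ₀ < μ) (hT : souslinNumber T ≤ μ)
    (hR : ∀ m, #(R m) < μ) {𝒟 : Set (Set X)} (h𝒟 : μ ≤ #𝒟)
    (hdense : ∀ D ∈ 𝒟, @Dense X (clopenExpansion T B) D) :
    ∃ D ∈ 𝒟, ∃ E ∈ 𝒟, D ≠ E ∧ ∃ d : Cell X M V P, d.IsAdmissible T R ∧
      ∀ S ⊆ d.carrier L B, κ ≤ #S → κ ≤ #(S ∩ (D ∩ E) : Set X) := by
  choose c hc hcD using fun D : 𝒟 => h.forced D (hdense D D.2)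
  obtain ⟨D, E, hne, d, hd, hsub⟩ :=
    exists_isAdmissible_carrier_subset hμ hμ' hT hR h𝒟 c hc L B
  refine ⟨D, D.2, E, E.2, fun h => hne (Subtype.ext h), d, hd, fun S hS hSκ => ?_⟩
  refine le_mk_inter_of_mk_sdiff_lt hκ hSκ ?_ ?_
  · exact (mk_le_mk_of_subset (Set.sdiff_subset_sdiff_left fun x hx => (hsub (hS hx)).1)).trans_lt
      (hcD D)
  · exact (mk_le_mk_of_subset (Set.sdiff_subset_sdiff_left fun x hx => (hsub (hS hx)).2)).trans_lt
      (hcD E)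

theorem exists_le_mk_inter (h : IsControlled T κ R L B) (hκ : ℵ₀ ≤ κ)
    {μ : Cardinal.{u}} (hμ : μ.IsRegular) (hμ' : ℵ₀ < μ) (hT : souslinNumber T ≤ μ)
    (hR : ∀ m, #(R m) < μ) {𝒟 : Set (Set X)} (h𝒟 : μ ≤ #𝒟)
    (hdense : ∀ D ∈ 𝒟, @Dense X (clopenExpansion T B) D) :
    ∃ D ∈ 𝒟, ∃ E ∈ 𝒟, D ≠ E ∧ κ ≤ #(D ∩ E : Set X) := by
  obtain ⟨D, hD, E, hE, hne, d, hd, hS⟩ :=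
    h.exists_isAdmissible_of_dense hκ hμ hμ' hT hR h𝒟 hdense
  exact ⟨D, hD, E, hE, hne, (hS _ subset_rfl (h.large d hd)).trans
    (mk_le_mk_of_subset Set.inter_subset_right)⟩

theorem not_isResolvable (h : IsControlled T κ R L B) (hκ : ℵ₀ ≤ κ)
    {μ ν : Cardinal.{u}} (hμ : μ.IsRegular) (hμ' : ℵ₀ < μ) (hT : souslinNumber T ≤ μ)
    (hR : ∀ m, #(R m) < μ) (hν : μ ≤ ν) : ¬ IsResolvable (clopenExpansion T B) ν := by
  rintro ⟨𝒟, rfl, hdense, hdisj⟩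
  obtain ⟨D, hD, E, hE, hne, hDE⟩ := h.exists_le_mk_inter hκ hμ hμ' hT hR hν hdense
  rw [Set.disjoint_iff_inter_eq_empty.1 (hdisj hD hE hne), mk_eq_zero] at hDE
  exact absurd (hκ.trans hDE) (not_le.2 aleph0_pos)

/-- If there is only one labelling function, two of regularly and uncountably many dense sets have
a somewhere dense intersection. -/
theorem exists_not_isNowhereDense_inter [Subsingleton M] (h : IsControlled T κ R L B)
    (hκ : ℵ₀ ≤ κ) {μ : Cardinal.{u}} (hμ : μ.IsRegular) (hμ' : ℵ₀ < μ)
    (hT : souslinNumber T ≤ μ) (hR : ∀ m, #(R m) < μ) {𝒟 : Set (Set X)} (h𝒟 : μ ≤ #𝒟)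
    (hdense : ∀ D ∈ 𝒟, @Dense X (clopenExpansion T B) D) :
    ∃ D ∈ 𝒟, ∃ E ∈ 𝒟, D ≠ E ∧ ¬ @IsNowhereDense X (clopenExpansion T B) (D ∩ E) := by
  obtain ⟨D, hD, E, hE, hne, d, hd, hS⟩ :=
    h.exists_isAdmissible_of_dense hκ hμ hμ' hT hR h𝒟 hdense
  refine ⟨D, hD, E, hE, hne, ?_⟩
  let _ : TopologicalSpace X := clopenExpansion T B
  have hopen : IsOpen (d.O ∩ patternSet B d.s d.e) := isOpen_inter_patternSet hd.isOpen B _ _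
  obtain ⟨x, hx⟩ := h.nonempty_carrier hκ hd
  rw [IsNowhereDense]
  refine Set.nonempty_iff_ne_empty.1 ⟨x, interior_maximal ?_ hopen ⟨hx.1.1, hx.2⟩⟩
  intro y hy
  refine mem_closure_iff.2 fun G hG hyG => ?_
  obtain ⟨O, s, e, hO, hyO, hsub⟩ := exists_inter_patternSet_subset (hopen.inter hG) ⟨hy, hyG⟩
  -- With one labelling function the pair condition is vacuous, so every smaller basic open set,
  -- with the labels of `d` kept, is again admissible and meets `D ∩ E`.
  let d' : Cell X M V P := ⟨O, d.t, d.a, s, e⟩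
  have hd' : d'.IsAdmissible T R :=
    ⟨hO, ⟨y, hyO.1⟩, hd.mem, fun m m' _ _ hne => absurd (Subsingleton.elim m m') hne⟩
  have hsub' : ∀ z ∈ d'.carrier L B, z ∈ d.O ∩ patternSet B d.s d.e ∩ G := fun z hz =>
    hsub ⟨hz.1.1, hz.2⟩
  have hlarge := hS (d'.carrier L B)
    (fun z hz => ⟨⟨(hsub' z hz).1.1, hz.1.2⟩, (hsub' z hz).1.2⟩) (h.large d' hd')
  have hne' : (d'.carrier L B ∩ (D ∩ E)).Nonempty := by
    rw [← Set.nonempty_coe_sort, ← mk_ne_zero_iff]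
    exact ((aleph0_pos.trans_le hκ).trans_le hlarge).ne'
  obtain ⟨z, hz, hzDE⟩ := hne'
  exact ⟨z, (hsub' z hz).2, hzDE⟩

/-- The sets of points with a given label witness resolvability. -/
theorem isResolvable [Nonempty X] (h : IsControlled T κ R L B) (hκ : ℵ₀ ≤ κ) (m : M) :
    IsResolvable (clopenExpansion T B) #(R m) := by
  have hd : Pairwise (Function.onFun Disjoint fun r : R m => {x | L m x = some (r : V)}) :=
    fun r r' hrr => Set.disjoint_left.2 fun x hx hx' =>
      hrr (Subtype.ext (Option.some_injective _ (hx.symm.trans hx')))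
  have hdense : ∀ r : R m, @Dense X (clopenExpansion T B) {x | L m x = some (r : V)} :=
    fun r => h.dense_label hκ r.2
  refine ⟨Set.range fun r : R m => {x | L m x = some (r : V)}, mk_range_eq _ fun r r' hrr => ?_,
    ?_, hd.range_pairwise⟩
  · obtain ⟨x, hx⟩ := @Dense.nonempty X (clopenExpansion T B) _ _ (hdense r)
    have hx' : L m x = some (r' : V) := (Set.ext_iff.1 hrr x).1 hx
    exact Subtype.ext (Option.some_injective _ (hx.symm.trans hx'))
  · rintro _ ⟨r, rfl⟩
    exact hdense r

theorem isExtraresolvable [Nonempty X] [Nonempty V] (h : IsControlled T κ R L B) (hκ : ℵ₀ ≤ κ)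
    {ι : Type u} (hι : Order.succ (dispersionCharacter (clopenExpansion T B)) ≤ #ι)
    {m : ι → M} (hm : Function.Injective m) (hR : ∀ i, (R (m i)).Nonempty) :
    IsExtraresolvable (clopenExpansion T B) := by
  choose r hr using hR
  let D : ι → Set X := fun i => {x | L (m i) x = some (r i)}
  have hdense : ∀ i, @Dense X (clopenExpansion T B) (D i) := fun i => h.dense_label hκ (hr i)
  have hnwd : ∀ i j, i ≠ j → @IsNowhereDense X (clopenExpansion T B) (D i ∩ D j) := by
    intro i j hij
    have hsub : D i ∩ D j ⊆ labelUnion L R (m i) ∩ labelUnion L R (m j) :=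
      fun x hx => ⟨⟨r i, hr i, hx.1⟩, ⟨r j, hr j, hx.2⟩⟩
    let _ : TopologicalSpace X := clopenExpansion T B
    exact IsNowhereDense.mono hsub (h.isNowhereDense_inter hκ (hm.ne hij))
  have hinj : Function.Injective D := by
    intro i j hij
    by_contra hne
    have h1 := hnwd i j hne
    let _ : TopologicalSpace X := clopenExpansion T B
    rw [← hij, Set.inter_self, IsNowhereDense, (hdense i).closure_eq, interior_univ] at h1
    exact Set.univ_nonempty.ne_empty h1
  refine ⟨Set.range D, by rwa [mk_range_eq D hinj], ?_, ?_⟩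
  · rintro _ ⟨i, rfl⟩
    exact hdense i
  · rintro _ ⟨i, rfl⟩ _ ⟨j, rfl⟩ hij
    exact hnwd i j fun h => hij (congrArg D h)

end IsControlled

end Controlled

/-! ### Cardinal bounds, suitability and the choice of labels. -/

section CardinalBounds

variable {X : Type u} {T : TopologicalSpace X}

theorem nonempty_of_souslinNumber_le (h : souslinNumber T ≤ dispersionCharacter T) :
    Nonempty X := by
  by_contra hX
  rw [not_nonempty_iff] at hX
  have h0 : dispersionCharacter T = 0 := by
    have : {c : Cardinal.{u} | ∃ U : Set X, IsOpen[T] U ∧ U.Nonempty ∧ #U = c} = ∅ :=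
      Set.eq_empty_iff_forall_notMem.2 fun c ⟨_, _, ⟨x, _⟩, _⟩ => isEmptyElim x
    rw [dispersionCharacter, this, Cardinal.sInf_empty]
  rw [h0] at h
  exact not_le_mk_of_souslinNumber_le h (C := ∅) ⟨by simp, Set.pairwise_empty _⟩ zero_le

theorem exists_isOpen_mk_eq_dispersionCharacter [Nonempty X] (T : TopologicalSpace X) :
    ∃ W : Set X, IsOpen[T] W ∧ W.Nonempty ∧ #W = dispersionCharacter T :=
  csInf_mem (s := {c | ∃ U : Set X, IsOpen[T] U ∧ U.Nonempty ∧ #U = c})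
    ⟨_, Set.univ, isOpen_univ, Set.univ_nonempty, rfl⟩

theorem aleph0_lt_souslinNumber [Nonempty X] (hT : @T2Space X T) (hc : IsCrowded T) :
    ℵ₀ < souslinNumber T := by
  have hinf : Infinite X := by
    by_contra hfin
    rw [not_infinite_iff_finite] at hfin
    exact hc (Classical.arbitrary X) (isOpen_discrete _)
  obtain ⟨G, hGinf, hGo, hGd⟩ := exists_seq_infinite_isOpen_pairwise_disjoint X
  by_contra hle
  obtain ⟨h1, h2⟩ := isCellularFamily_range (T := T) (O := fun n : ULift.{u} ℕ => G n.down)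
    (fun n => hGo _) (fun n => (hGinf _).nonempty)
    (fun n n' hn => hGd fun h => hn (ULift.ext _ _ h))
  refine not_le_mk_of_souslinNumber_le (not_lt.1 hle) h1 ?_
  rw [h2]
  simp

/-- Between the Souslin number and any upper bound for it there is a regular cardinal. -/
theorem exists_isRegular_souslinNumber_le (T : TopologicalSpace X) {κ : Cardinal.{u}}
    (hκ : ℵ₀ ≤ κ) (h : souslinNumber T ≤ κ) :
    ∃ μ : Cardinal.{u}, μ.IsRegular ∧ souslinNumber T ≤ μ ∧ μ ≤ κ := by
  by_cases hS : ℵ₀ ≤ souslinNumber T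
  · exact ⟨_, IsRegular.of_not_isSingular hS (not_isSingular_souslinNumber T), le_rfl, h⟩
  · exact ⟨ℵ₀, isRegular_aleph0, (not_le.1 hS).le, hκ⟩

end CardinalBounds

/-- The bound on cellular families needs a regular cardinal, while κ may be singular; the
Erdős–Tarski theorem supplies one between the old Souslin number and κ. -/
theorem exists_suitable_controlled_expansion {X V M : Type u} [Infinite V]
    {T : TopologicalSpace X} (hTych : @T35Space X T) (hmax : IsMaximallyResolvable T)
    (hS : souslinNumber T ≤ dispersionCharacter T) (hS' : ℵ₀ < souslinNumber T)
    (hV : #V = dispersionCharacter T) (hM : #M ≤ 2 ^ #V) (R : M → Set V) :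
    ∃ (P : Type u) (L : M → X → Option V) (B : P ⊕ M × M × ℕ → Set X),
      IsControlled T #V R L B ∧ IsSuitableExpansion T (clopenExpansion T B) := by
  have hX := nonempty_of_souslinNumber_le hS
  obtain ⟨W, hW, hWne, hWcard⟩ := exists_isOpen_mk_eq_dispersionCharacter T
  rw [← hV] at hWcard
  obtain ⟨L, B, h⟩ := exists_isControlled hmax hV hM R hW hWne hWcard
  have hΔ := h.dispersionCharacter_eq hW hWne hWcard
  obtain ⟨μ, hμ, hSμ, hμV⟩ := exists_isRegular_souslinNumber_le T (aleph0_le_mk V) (hV ▸ hS)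
  refine ⟨Set W, L, B, h, clopenExpansion_le T B, t35Space_clopenExpansion hTych B,
    hΔ.trans hV, ?_⟩
  rw [hΔ]
  exact (h.souslinNumber_le (aleph0_le_mk V) hμ (hS'.trans_le hSμ) hSμ).trans hμV

end Resolvability

open Resolvability in
theorem theorem4p2 {X : Type u} (T : TopologicalSpace X) (hTych : @T35Space X T)
    (hcrowded : Resolvability.IsCrowded T)
    (hmax : Resolvability.IsMaximallyResolvable T)
    (hS : Resolvability.souslinNumber T ≤ Resolvability.dispersionCharacter T) :
    (∃ U₁ : TopologicalSpace X, Resolvability.IsSuitableExpansion T U₁ ∧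
      Resolvability.IsResolvable U₁ Cardinal.aleph0 ∧
      ¬ Resolvability.IsMaximallyResolvable U₁) ∧
    (∀ κ' : Cardinal.{u}, κ'.IsRegular →
      Resolvability.souslinNumber T ≤ κ' → κ' ≤ Resolvability.dispersionCharacter T →
      ∃ U₂ : TopologicalSpace X, Resolvability.IsSuitableExpansion T U₂ ∧
        (∀ τ : Cardinal.{u}, τ < κ' → Resolvability.IsResolvable U₂ τ) ∧
        ¬ Resolvability.IsResolvable U₂ κ') ∧
    (∃ U₃ : TopologicalSpace X, Resolvability.IsSuitableExpansion T U₃ ∧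
      Resolvability.IsMaximallyResolvable U₃ ∧
      ¬ Resolvability.IsExtraresolvable U₃) ∧
    (∃ U₄ : TopologicalSpace X, Resolvability.IsSuitableExpansion T U₄ ∧
      Resolvability.IsExtraresolvable U₄ ∧
      ¬ Resolvability.IsMaximallyResolvable U₄) ∧
    (∃ U₅ : TopologicalSpace X, Resolvability.IsSuitableExpansion T U₅ ∧
      Resolvability.IsMaximallyResolvable U₅ ∧
      Resolvability.IsExtraresolvable U₅ ∧
      ¬ Resolvability.IsStronglyExtraresolvable U₅) := by
  have hX := nonempty_of_souslinNumber_le hS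
  have hT2 : @T2Space X T := inferInstance
  have hS' := aleph0_lt_souslinNumber hT2 hcrowded
  obtain ⟨V, hV⟩ : ∃ V : Type u, #V = dispersionCharacter T := ⟨_, mk_out _⟩
  have hκ : ℵ₀ ≤ #V := hV ▸ (hS'.le.trans hS)
  have hVinf : Infinite V := infinite_iff.2 hκ
  have hsucc : (Order.succ #V).IsRegular := isRegular_succ hκ
  have hsucc' : ℵ₀ < Order.succ #V := Order.lt_succ_of_le hκ
  have hSsucc : souslinNumber T ≤ Order.succ #V := (hV ▸ hS).trans (Order.le_succ _)
  have hsuccpow : Order.succ #V ≤ 2 ^ #V := Order.succ_le_of_lt (cantor _)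
  have h1pow : (1 : Cardinal.{u}) ≤ 2 ^ #V := one_le_two.trans ((self_le_power 2 (one_le_aleph0.trans hκ)))
  have hpow : ℵ₀ ≤ (2 : Cardinal.{u}) ^ #V := hκ.trans (cantor _).le
  obtain ⟨Γ, hΓ⟩ : ∃ Γ : Type u, #Γ = Order.succ #V := ⟨_, mk_out _⟩
  obtain ⟨v₀⟩ : Nonempty V := inferInstance
  obtain ⟨μ, hμ, hSμ, hμκ⟩ := exists_isRegular_souslinNumber_le T hκ (hV ▸ hS)
  have hμ' : ℵ₀ < μ := hS'.trans_le hSμ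
  have part2 : ∀ κ' : Cardinal.{u}, κ'.IsRegular → souslinNumber T ≤ κ' →
      κ' ≤ dispersionCharacter T → ∃ U₂ : TopologicalSpace X, IsSuitableExpansion T U₂ ∧
        (∀ τ : Cardinal.{u}, τ < κ' → IsResolvable U₂ τ) ∧
        ∀ ν : Cardinal.{u}, κ' ≤ ν → ¬ IsResolvable U₂ ν := by
    intro κ' hreg hSκ' hκ'
    -- One labelling for each set of fewer than `κ'` labels: this realises every `τ < κ'` while
    -- keeping all label sets below `κ'`.
    obtain ⟨P, L, B, h, hsuit⟩ := exists_suitable_controlled_expansion hTych hmax hS hS' hV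
      (M := {R : Set V // #R < κ'}) ((mk_subtype_le _).trans_eq (mk_set)) Subtype.val
    refine ⟨_, hsuit, fun τ hτ => ?_, fun ν hν =>
      h.not_isResolvable hκ hreg (hS'.trans_le hSκ') hSκ' (fun R => R.2) hν⟩
    obtain ⟨R, hR⟩ := le_mk_iff_exists_set.1 ((hτ.le.trans hκ').trans_eq hV.symm)
    have := h.isResolvable hκ ⟨R, hR.trans_lt hτ⟩
    rwa [show #(R : Set V) = τ from hR] at this
  refine ⟨?_, ?_, ?_, ?_, ?_⟩
  · obtain ⟨U, hU, hres, hnot⟩ := part2 μ hμ hSμ (hV ▸ hμκ)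
    refine ⟨U, hU, hres _ hμ', hnot _ ?_⟩
    rw [hU.dispersionCharacter_eq, ← hV]
    exact hμκ
  · intro κ' hreg hSκ' hκ'
    obtain ⟨U, hU, hres, hnot⟩ := part2 κ' hreg hSκ' hκ'
    exact ⟨U, hU, hres, hnot κ' le_rfl⟩
  -- A single labelling with all κ labels.
  · obtain ⟨P, L, B, h, hsuit⟩ := exists_suitable_controlled_expansion hTych hmax hS hS' hV
      (M := PUnit.{u + 1}) (by simpa using h1pow) fun _ => Set.univ
    have hΔ := hsuit.dispersionCharacter_eq.trans hV.symm
    refine ⟨_, hsuit, ?_, ?_⟩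
    · have := h.isResolvable hκ PUnit.unit
      rwa [mk_univ, ← hΔ] at this
    · rintro ⟨𝒟, hcard, hdense, hpair⟩
      rw [hΔ] at hcard
      obtain ⟨D, hD, E, hE, hne, hDE⟩ := h.exists_not_isNowhereDense_inter hκ hsucc hsucc' hSsucc
        (fun _ => by rw [mk_univ]; exact Order.lt_succ _) hcard hdense
      exact hDE (hpair hD hE hne)
  -- κ⁺ labellings with one label each give κ⁺ dense sets with nowhere dense intersections; label
  -- sets of size one are below `μ ≤ κ`, which excludes κ disjoint dense sets.
  · obtain ⟨P, L, B, h, hsuit⟩ := exists_suitable_controlled_expansion hTych hmax hS hS' hV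
      (M := Γ) (by rwa [hΓ]) fun _ => {v₀}
    have hΔ := hsuit.dispersionCharacter_eq.trans hV.symm
    refine ⟨_, hsuit, h.isExtraresolvable hκ (by rw [hΔ, hΓ]) Function.injective_id
      (fun _ => Set.singleton_nonempty v₀), ?_⟩
    rw [IsMaximallyResolvable, hΔ]
    exact h.not_isResolvable hκ hμ hμ' hSμ
      (fun _ => by rw [mk_singleton]; exact one_lt_aleph0.trans hμ') hμκ
  -- The two previous choices combined: `none` carries all κ labels, and each element of `Γ` a
  -- single one.
  · obtain ⟨P, L, B, h, hsuit⟩ := exists_suitable_controlled_expansion hTych hmax hS hS' hV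
      (M := Option Γ)
      (by rw [mk_option, hΓ]; exact add_le_of_le hpow hsuccpow h1pow)
      fun m => m.elim Set.univ fun _ => {v₀}
    have hΔ := hsuit.dispersionCharacter_eq.trans hV.symm
    refine ⟨_, hsuit, ?_, h.isExtraresolvable hκ (by rw [hΔ, hΓ]) (Option.some_injective _)
      (fun _ => Set.singleton_nonempty v₀), ?_⟩
    · have := h.isResolvable hκ none
      change IsResolvable _ #(Set.univ : Set V) at this
      rwa [mk_univ, ← hΔ] at this
    · rintro ⟨𝒟, hcard, hdense, hpair⟩
      rw [hΔ] at hcard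
      obtain ⟨D, hD, E, hE, hne, hDE⟩ := h.exists_le_mk_inter hκ hsucc hsucc' hSsucc
        (by
          rintro (_ | m)
          · change #(Set.univ : Set V) < _
            rw [mk_univ]
            exact Order.lt_succ _
          · change #({v₀} : Set V) < _
            rw [mk_singleton]
            exact one_lt_aleph0.trans hsucc') hcard hdense
      -- A nonempty open set of size κ shows that the nowhere density number is at most κ, whereas
      -- `D ∩ E` has at least κ points.
      refine absurd (hpair hD hE hne) (not_lt.2 (le_trans ?_ hDE))
      obtain ⟨W, hW, hWne, hWcard⟩ := exists_isOpen_mk_eq_dispersionCharacter (clopenExpansion T B)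
      rw [← hΔ, ← hWcard]
      refine csInf_le' ⟨W, hWne.mono ?_, rfl⟩
      exact @interior_maximal X (clopenExpansion T B) _ _
        (@subset_closure X (clopenExpansion T B) W) hW
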